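/- Let $n\in\mathbb N$ and work with (real) algebraic varieties in $\mathbb R^n$, i.e. common real zero sets of finitely many polynomials in $\mathbb R[x_1,\dots,x_n]$ (the empty set included). A variety is irreducible if it is not the union of two proper subvarieties; in particular $\emptyset$ counts as irreducible. The irreducible components of a variety $U$ are irreducible varieties $U_1,\dots,U_r$ ($r\ge 1$) with $U=U_1\cup\dots\cup U_r$ and $U_j\not\subset U_t$ for $j\neq t$ (so $\emptyset$ has the single component $\emptyset$). The dimension $\dim V$ is the largest $k$ such that $V$ is, near some point of it, a smooth $k$-dimensional submanifold of $\mathbb R^n$, with $\dim\emptyset=0$. If $h=(h_1,\dots,h_l)$ generates the vanishing ideal $I(V)$, a point $a\in V$ is regular if the Jacobian matrix $J(h)(a)$ has rank $n-\dim V$; the singular locus $V^{\mathrm{sing}}$ is the set of the points of $V$ that are not regular. Consider the following algorithm, whose input is an algebraic variety $V$ in $\mathbb R^n$ and whose output is a pair $A,B$ of sets of subvarieties of $V$. 1. Set $U:=V$, $A:=\emptyset$, $B:=\emptyset$. 2. Let $U_1,\dots,U_r$ be the irreducible components of $U$. 3. Set $A:=A\cup\{U_1,\dots,U_r\}$. 4.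 For $j=1,\dots,r$: (a) if $U_j$ is zero-dimensional, set $A:=A\setminus\{U_j\}$ and $B:=B\cup\{U_j\}$; (b) otherwise set $U:=U_j^{\mathrm{sing}}$ and run Steps 2, 3, 4 again (recursively, before the loop continues). Then, for every input $V$, the algorithm is well defined and terminates after finitely many steps, and its output $A,B$ satisfies: 1. $A$ and $B$ are finite sets of algebraic varieties in $\mathbb R^n$. 2. Each variety in $A$ is irreducible and positive-dimensional. 3. Each variety in $B$ is irreducible and zero-dimensional. 4. $V=\bigcup_{W\in A\cup B}W$. -/

import Mathlib

open scoped ContDiff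

namespace SingDecomp

noncomputable section

/-- The real algebraic variety `V(h)` defined by finitely many polynomials `h₁, …, h_l`. -/
def realZeros {n l : ℕ} (h : Fin l → MvPolynomial (Fin n) ℝ) : Set (Fin n → ℝ) :=
  {x | ∀ j, MvPolynomial.eval x (h j) = 0}

/-- `V` is an algebraic variety in `ℝⁿ` (the empty set is one). -/
def IsVariety {n : ℕ} (V : Set (Fin n → ℝ)) : Prop :=
  ∃ (l : ℕ) (h : Fin l → MvPolynomial (Fin n) ℝ), V = realZeros h

/-- `V` is an irreducible variety: it is not the union of two proper subvarieties.
With this convention the empty variety is irreducible. -/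
def IsIrredVariety {n : ℕ} (V : Set (Fin n → ℝ)) : Prop :=
  IsVariety V ∧
    ¬ ∃ V₁ V₂ : Set (Fin n → ℝ), IsVariety V₁ ∧ IsVariety V₂ ∧ V₁ ⊂ V ∧ V₂ ⊂ V ∧ V = V₁ ∪ V₂

/-- `L` lists, in some order, the irreducible components `V₁, …, V_r` (`r ≥ 1`) of `U`: they are
irreducible varieties with union `U`, and `V_j ⊄ V_t` for `j ≠ t`. The empty variety has the
single component `∅`. -/
def IsIrredDecomp {n : ℕ} (U : Set (Fin n → ℝ)) (L : List (Set (Fin n → ℝ))) : Prop :=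
  L ≠ [] ∧ (∀ W ∈ L, IsIrredVariety W) ∧ L.Pairwise (fun W W' => ¬ W ⊆ W' ∧ ¬ W' ⊆ W) ∧
    U = ⋃ W ∈ L, W

/-- Near its point `a`, the set `V` is a smooth submanifold of `ℝⁿ` of dimension `k`: a smooth
chart of `ℝⁿ` around `a` flattens `V` to the coordinate subspace on which all but the first `k`
coordinates vanish. -/
def IsSubmanifoldAt {n : ℕ} (V : Set (Fin n → ℝ)) (k : ℕ) (a : Fin n → ℝ) : Prop :=
  k ≤ n ∧ a ∈ V ∧ ∃ φ : OpenPartialHomeomorph (Fin n → ℝ) (Fin n → ℝ),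
    a ∈ φ.source ∧ ContDiffOn ℝ ∞ φ φ.source ∧ ContDiffOn ℝ ∞ φ.symm φ.target ∧
      φ '' (V ∩ φ.source) = {y ∈ φ.target | ∀ i : Fin n, k ≤ (i : ℕ) → y i = 0}

/-- The dimension of `V`: the highest dimension at points at which `V` is a real submanifold.
The supremum is over a set of naturals bounded by `n`; it is `0` for `V = ∅`. -/
def dim {n : ℕ} (V : Set (Fin n → ℝ)) : ℕ :=
  sSup {k | ∃ a, IsSubmanifoldAt V k a}

/-- The vanishing ideal `I(V)`. -/
def idealOf {n : ℕ} (V : Set (Fin n → ℝ)) : Ideal (MvPolynomial (Fin n) ℝ) :=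
  MvPolynomial.vanishingIdeal ℝ V

/-- The Jacobian matrix `J(h)(a) = (∂h_j/∂x_t (a))_{t, j}`. -/
def jacobian {n l : ℕ} (h : Fin l → MvPolynomial (Fin n) ℝ) (a : Fin n → ℝ) :
    Matrix (Fin n) (Fin l) ℝ :=
  Matrix.of fun t j => MvPolynomial.eval a (MvPolynomial.pderiv t (h j))

/-- The regular locus: the points `a` of `V` at which the Jacobian matrix of generators `h` of
`I(V)` has rank `n - dim V` (the rank does not depend on the choice of generators). -/
def regLocus {n : ℕ} (V : Set (Fin n → ℝ)) : Set (Fin n → ℝ) :=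
  {a | a ∈ V ∧ ∃ (l : ℕ) (h : Fin l → MvPolynomial (Fin n) ℝ),
    Ideal.span (Set.range h) = idealOf V ∧ (jacobian h a).rank + dim V = n}

/-- The singular locus of `V`. -/
def singLocus {n : ℕ} (V : Set (Fin n → ℝ)) : Set (Fin n → ℝ) :=
  V \ regLocus V

/-- Pending work of the algorithm: `decompose U` stands for "run Steps 2, 3, 4 with the current
`U`", and `examine W` for one iteration of the loop of Step 4, with `U_j = W`. -/
inductive Task (n : ℕ) where
  | decompose (U : Set (Fin n → ℝ))
  | examine (W : Set (Fin n → ℝ))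

/-- A state of the algorithm: the stack of pending work and the current values of `A` and `B`. -/
structure State (n : ℕ) where
  todo : List (Task n)
  A : Set (Set (Fin n → ℝ))
  B : Set (Set (Fin n → ℝ))

/-- Step 1: `U := V`, `A := ∅`, `B := ∅`. -/
def start {n : ℕ} (V : Set (Fin n → ℝ)) : State n :=
  ⟨[Task.decompose V], ∅, ∅⟩

/-- One step of the algorithm. -/
inductive Step {n : ℕ} : State n → State n → Prop
  /-- Steps 2 and 3: take the irreducible components `U₁, …, U_r` of `U`, add them all to `A`, and
  enter the loop over them. -/
  | decompose (U : Set (Fin n → ℝ)) (L : List (Set (Fin n → ℝ))) (rest : List (Task n))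
      (A B : Set (Set (Fin n → ℝ))) (hL : IsIrredDecomp U L) :
      Step ⟨Task.decompose U :: rest, A, B⟩ ⟨L.map Task.examine ++ rest, A ∪ {W | W ∈ L}, B⟩
  /-- Step 4 (a): move a zero-dimensional `U_j` from `A` to `B`. -/
  | zeroDim (W : Set (Fin n → ℝ)) (rest : List (Task n)) (A B : Set (Set (Fin n → ℝ)))
      (hW : dim W = 0) :
      Step ⟨Task.examine W :: rest, A, B⟩ ⟨rest, A \ {W}, B ∪ {W}⟩
  /-- Step 4 (b): otherwise run Steps 2, 3, 4 again on the singular locus of `U_j`. -/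
  | posDim (W : Set (Fin n → ℝ)) (rest : List (Task n)) (A B : Set (Set (Fin n → ℝ)))
      (hW : dim W ≠ 0) :
      Step ⟨Task.examine W :: rest, A, B⟩ ⟨Task.decompose (singLocus W) :: rest, A, B⟩

/-- `s` can be reached by the algorithm with input `V`. -/
def Reaches {n : ℕ} (V : Set (Fin n → ℝ)) (s : State n) : Prop :=
  Relation.ReflTransGen Step (start V) s

/-- With input `V` the algorithm may finish (no pending work is left) with output `A`, `B`. -/
def Outputs {n : ℕ} (V : Set (Fin n → ℝ)) (A B : Set (Set (Fin n → ℝ))) : Prop :=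
  Reaches V ⟨[], A, B⟩

/-- The algorithm terminates on input `V`: no run is infinite, and no run gets stuck while there
is pending work. -/
def Terminates {n : ℕ} (V : Set (Fin n → ℝ)) : Prop :=
  (¬ ∃ s : ℕ → State n, s 0 = start V ∧ ∀ t, Step (s t) (s (t + 1))) ∧
    ∀ s, Reaches V s → s.todo ≠ [] → ∃ s', Step s s'

end

end SingDecomp

/-! Soundness of the output is an invariant of the stack machine. The geometric content is that the
singular locus of an irreducible variety `V` with `dim V ≠ 0` is a variety strictly smaller than
`V`. Noetherian induction then shows that every run is finite.

Let `r(a)` be the dimension of the space of gradients at `a` of all polynomials in `I(V)`; for `a ∈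
V` this is the Jacobian rank for any generators.

Upper bound: `r(a) + dim V ≤ n` at every `a ∈ V`. A chart of dimension `k` yields `k` linear forms
that map some piece of `V` onto a set containing an open set, so they are algebraically independent
modulo `I(V)`. Gradients independent at `a` stay independent over the function field `K` and die in
the Kähler differentials of `K` over `ℝ`, where the differentials of the `k` forms are independent.
Rank-nullity on `Kⁿ` gives the bound (`finrank_gradSpace_add_le`).

Attainment: where `r` is maximal, `V` is a submanifold of dimension `n - r`
(`isSubmanifoldAt_of_finrank`), so `n - r ≤ dim V` there, and a regular point exists. The issue is
that `V` fills the manifold cut out by `r` of its equations. Maximality puts the larger minors in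
`I(V)`, so along a path in that manifold the generators of `I(V)` solve a homogeneous linear
differential equation with zero initial value. -/

namespace SingDecomp

open MvPolynomial

/-! ### Kähler differentials and rank-nullity over the function field -/

section Differentials

open scoped nonZeroDivisors TensorProduct
open KaehlerDifferential

/-- In characteristic zero, the differentials of algebraically independent elements of a finitely
generated field extension are linearly independent. -/
theorem linearIndependent_D_of_algebraicIndependent {F K ι : Type} [Field F] [CharZero F] [Field K]
    [Algebra F K] [Algebra.EssFiniteType F K] {y : ι → K} (hy : AlgebraicIndependent F y) :
    LinearIndependent K (fun i => D F K (y i)) := by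
  let S := MvPolynomial ι F
  algebraize [(aeval y : S →ₐ[F] K).toRingHom]
  have : IsScalarTower F S K := .of_algebraMap_eq' (aeval y : S →ₐ[F] K).comp_algebraMap.symm
  have : FaithfulSMul S K := (faithfulSMul_iff_algebraMap_injective S K).2 hy
  let L := FractionRing S
  let : Algebra L K := FractionRing.liftAlgebra S K
  have : IsScalarTower S L K := FractionRing.isScalarTower_liftAlgebra S K
  have : IsScalarTower F L K := .to₁₃₄ F S L K
  have : CharZero L := charZero_of_injective_algebraMap (algebraMap F L).injective
  have : Algebra.EssFiniteType L K := Algebra.EssFiniteType.of_comp F L K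
  -- `S → L` is a localization and `L → K` is a field extension in characteristic zero, so `K` is
  -- formally smooth over `S`. Its first cotangent homology therefore vanishes, which makes the base
  -- change map on differentials injective.
  have : Algebra.FormallySmooth S L := .of_isLocalization S⁰
  have : Algebra.FormallySmooth S K := .comp S L K
  have hinj : Function.Injective (mapBaseChange F S K) := by
    rw [injective_iff_map_eq_zero]
    intro x hx
    obtain ⟨x, rfl⟩ := (Algebra.H1Cotangent.exact_δ_mapBaseChange F S K x).mp hx
    rw [Subsingleton.elim x 0, map_zero]
  have hb := ((mvPolynomialBasis F ι).baseChange K).linearIndependent.map'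
    (mapBaseChange F S K) (LinearMap.ker_eq_bot.2 hinj)
  have he : (fun i => D F K (y i)) =
      mapBaseChange F S K ∘ (mvPolynomialBasis F ι).baseChange K := by
    ext i
    rw [Function.comp_apply, Module.Basis.baseChange_apply, mvPolynomialBasis_apply]
    refine Eq.trans ?_ (mapBaseChange_tmul F S K (1 : K) (D F S (X i))).symm
    rw [one_smul, map_D]
    exact congrArg (D F K) (aeval_X y i).symm
  rw [he]
  exact hb

/-- Elements of a prime ideal whose gradients are linearly independent over the function field
bound the number of elements algebraically independent modulo the ideal. -/
theorem add_le_of_algebraicIndependent {F : Type} [Field F] [CharZero F] {n r k : ℕ}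
    (p : Ideal (MvPolynomial (Fin n) F)) [p.IsPrime] (K : Type) [Field K]
    [Algebra F K] [Algebra (MvPolynomial (Fin n) F ⧸ p) K] [IsScalarTower F (_ ⧸ p) K]
    [IsFractionRing (MvPolynomial (Fin n) F ⧸ p) K]
    (y : Fin k → MvPolynomial (Fin n) F)
    (hy : AlgebraicIndependent F fun i => Ideal.Quotient.mk p (y i))
    (f : Fin r → MvPolynomial (Fin n) F) (hf : ∀ j, f j ∈ p)
    (hind : LinearIndependent K fun j t =>
      algebraMap (_ ⧸ p) K (Ideal.Quotient.mk p (pderiv t (f j)))) : r + k ≤ n := by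
  have : Algebra.EssFiniteType (MvPolynomial (Fin n) F ⧸ p) K := .of_isLocalization _ (_)⁰
  have : Algebra.EssFiniteType F K := .comp F (MvPolynomial (Fin n) F ⧸ p) K
  let q : MvPolynomial (Fin n) F →ₐ[F] K :=
    (IsScalarTower.toAlgHom F (_ ⧸ p) K).comp (Ideal.Quotient.mkₐ F p)
  have hyK : AlgebraicIndependent F fun i => q (y i) :=
    hy.map' (f := IsScalarTower.toAlgHom F (_ ⧸ p) K) (IsFractionRing.injective _ _)
  have hD := linearIndependent_D_of_algebraicIndependent hyK
  -- By the chain rule `T` sends the gradient of `g` to the differential of `g`. So the gradients of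
  -- the `f j` lie in its kernel and the differentials of the `y i` in its range.
  let T : (Fin n → K) →ₗ[K] Ω[K⁄F] := Fintype.linearCombination K fun t => D F K (q (X t))
  have hT (g : MvPolynomial (Fin n) F) : T (fun t => q (pderiv t g)) = D F K (q g) := by
    simp only [T, Fintype.linearCombination_apply]
    induction g using MvPolynomial.induction_on with
    | C a => simp [algHom_C]
    | add g₁ g₂ h₁ h₂ => simp only [map_add, add_smul, Finset.sum_add_distrib, h₁, h₂]
    | mul_X g s h =>
      simp only [Derivation.leibniz, map_add, map_mul, smul_eq_mul, add_smul, mul_smul,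
        Finset.sum_add_distrib, ← Finset.smul_sum, h, pderiv_X]
      congr 1
      rw [Finset.sum_eq_single s] <;> simp +contextual [eq_comm]
  have hker : r ≤ Module.finrank K (LinearMap.ker T) := by
    have hv (j : Fin r) : (fun t => q (pderiv t (f j))) ∈ LinearMap.ker T := by
      rw [LinearMap.mem_ker, hT]
      have : q (f j) = 0 := by
        simp [q, Ideal.Quotient.eq_zero_iff_mem.2 (hf j)]
      rw [this, map_zero]
    have : LinearIndependent K fun j => (⟨_, hv j⟩ : LinearMap.ker T) :=
      .of_comp (LinearMap.ker T).subtype hind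
    simpa using this.fintype_card_le_finrank
  have hrange : k ≤ Module.finrank K (LinearMap.range T) := by
    have : LinearIndependent K fun i => (⟨_, _, hT (y i)⟩ : LinearMap.range T) :=
      .of_comp (LinearMap.range T).subtype hD
    simpa using this.fintype_card_le_finrank
  have := T.finrank_range_add_finrank_ker
  rw [Module.finrank_fin_fun] at this
  omega

end Differentials

/-! ### Varieties, vanishing ideals and irreducible components -/

section Varieties

variable {n : ℕ}

theorem mem_idealOf {V : Set (Fin n → ℝ)} {f : MvPolynomial (Fin n) ℝ} :
    f ∈ idealOf V ↔ ∀ x ∈ V, eval x f = 0 :=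
  Iff.rfl

/-- By Hilbert's basis theorem, the common zeros of any set of polynomials form a variety. -/
theorem isVariety_zeros (S : Set (MvPolynomial (Fin n) ℝ)) :
    IsVariety {x | ∀ f ∈ S, eval x f = 0} := by
  obtain ⟨l, h, hh⟩ := Submodule.fg_iff_exists_fin_generating_family.1
    (IsNoetherian.noetherian (Ideal.span S))
  have key (T : Set (MvPolynomial (Fin n) ℝ)) (x : Fin n → ℝ) :
      (∀ f ∈ T, eval x f = 0) ↔ Ideal.span T ≤ RingHom.ker (eval x) := by
    rw [Ideal.span_le]; rfl
  refine ⟨l, h, ?_⟩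
  ext x
  rw [Set.mem_ofPred_eq, key, ← hh]
  exact (key (Set.range h) x).symm.trans (by simp [realZeros])

theorem IsVariety.mem_of_forall {V : Set (Fin n → ℝ)} (hV : IsVariety V) {x : Fin n → ℝ}
    (hx : ∀ f ∈ idealOf V, eval x f = 0) : x ∈ V := by
  obtain ⟨l, h, rfl⟩ := hV
  exact fun j => hx (h j) fun y hy => hy j

theorem IsVariety.inter_zeros {V : Set (Fin n → ℝ)} (hV : IsVariety V)
    (S : Set (MvPolynomial (Fin n) ℝ)) : IsVariety {x | x ∈ V ∧ ∀ f ∈ S, eval x f = 0} := by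
  convert isVariety_zeros ((idealOf V : Set (MvPolynomial (Fin n) ℝ)) ∪ S) using 1
  ext x
  simp only [Set.mem_ofPred_eq, Set.mem_union, or_imp, forall_and]
  exact and_congr_left fun _ => ⟨fun hx f hf => hf x hx, hV.mem_of_forall⟩

theorem idealOf_lt_of_ssubset {V W : Set (Fin n → ℝ)} (hV : IsVariety V) (h : V ⊂ W) :
    idealOf W < idealOf V :=
  ⟨fun _ hf x hx => hf x (h.1 hx), fun hle =>
    h.2 fun _ hx => hV.mem_of_forall fun _ hf => hle hf _ hx⟩

/-- Noetherian induction on varieties. -/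
theorem IsVariety.induction {P : Set (Fin n → ℝ) → Prop}
    (ih : ∀ V, IsVariety V → (∀ W, IsVariety W → W ⊂ V → P W) → P V) {V : Set (Fin n → ℝ)}
    (hV : IsVariety V) : P V := by
  induction hI : idealOf V using WellFoundedGT.induction generalizing V with
  | ind I hrec =>
    subst hI
    exact ih V hV fun W hW hlt => hrec _ (idealOf_lt_of_ssubset hW hlt) hW rfl

/-- If `f * g` vanishes on `V` but neither factor does, the zeros of `f` and of `g` split `V` into
two proper subvarieties. Nonemptiness is needed because `∅` counts as irreducible and has the unit
ideal. -/
theorem IsIrredVariety.isPrime {V : Set (Fin n → ℝ)} (hV : IsIrredVariety V) (hne : V.Nonempty) :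
    (idealOf V).IsPrime := by
  refine Ideal.isPrime_iff.2 ⟨?_, fun {f g} hfg => ?_⟩
  · obtain ⟨x, hx⟩ := hne
    exact (Ideal.ne_top_iff_one _).2 fun h1 => by simpa using mem_idealOf.1 h1 x hx
  · by_contra! hcon
    have hss {f} (hf : f ∉ idealOf V) : {x | x ∈ V ∧ ∀ g ∈ ({f} : Set _), eval x g = 0} ⊂ V :=
      ⟨fun x hx => hx.1, fun hle => hf fun x hx => (hle hx).2 f rfl⟩
    refine hV.2 ⟨_, _, hV.1.inter_zeros {f}, hV.1.inter_zeros {g}, hss hcon.1, hss hcon.2, ?_⟩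
    ext x
    have := mem_idealOf.1 hfg x
    simp only [map_mul, mul_eq_zero] at this
    simp only [Set.mem_union, Set.mem_ofPred_eq, Set.mem_singleton_iff, forall_eq]
    tauto

theorem IsVariety.exists_finset_irred {U : Set (Fin n → ℝ)} (hU : IsVariety U) :
    ∃ S : Finset (Set (Fin n → ℝ)), S.Nonempty ∧ (∀ W ∈ S, IsIrredVariety W) ∧ U = ⋃ W ∈ S, W := by
  classical
  refine hU.induction (P := fun U => ∃ S : Finset (Set (Fin n → ℝ)),
    S.Nonempty ∧ (∀ W ∈ S, IsIrredVariety W) ∧ U = ⋃ W ∈ S, W) fun U hU ih => ?_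
  by_cases hirr : IsIrredVariety U
  · exact ⟨{U}, by simp, by simpa using hirr, by simp⟩
  · obtain ⟨V₁, V₂, h₁, h₂, hs₁, hs₂, rfl⟩ : ∃ V₁ V₂ : Set (Fin n → ℝ), IsVariety V₁ ∧
        IsVariety V₂ ∧ V₁ ⊂ U ∧ V₂ ⊂ U ∧ U = V₁ ∪ V₂ := by
      by_contra hcon
      exact hirr ⟨hU, hcon⟩
    obtain ⟨S₁, hn, hi₁, hu₁⟩ := ih _ h₁ hs₁
    obtain ⟨S₂, -, hi₂, hu₂⟩ := ih _ h₂ hs₂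
    refine ⟨S₁ ∪ S₂, hn.mono Finset.subset_union_left, fun W hW => ?_, ?_⟩
    · exact (Finset.mem_union.1 hW).elim (hi₁ W) (hi₂ W)
    · rw [Finset.set_biUnion_union, ← hu₁, ← hu₂]

/-- Keeping only the inclusion-maximal members of a finite irreducible cover preserves the union and
removes all inclusions. -/
theorem IsVariety.exists_isIrredDecomp {U : Set (Fin n → ℝ)} (hU : IsVariety U) :
    ∃ L, IsIrredDecomp U L := by
  classical
  obtain ⟨S, hn, hirr, hu⟩ := hU.exists_finset_irred
  let M := S.filter fun W => ∀ W' ∈ S, W ⊆ W' → W' ⊆ W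
  have hle (W) (hW : W ∈ S) : ∃ W' ∈ M, W ⊆ W' := by
    obtain ⟨W', hWW', hmax⟩ := S.exists_le_maximal hW
    exact ⟨W', Finset.mem_filter.2 ⟨hmax.1, fun T hT hle => hmax.2 hT hle⟩, hWW'⟩
  refine ⟨M.toList, ?_, ?_, ?_, ?_⟩
  · obtain ⟨W, hW⟩ := hn
    obtain ⟨W', hW', -⟩ := hle W hW
    exact List.ne_nil_of_mem (Finset.mem_toList.2 hW')
  · intro W hW
    exact hirr W (Finset.mem_filter.1 (Finset.mem_toList.1 hW)).1
  · refine M.nodup_toList.imp_of_mem fun {W W'} hW hW' hne => ?_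
    have h₁ := Finset.mem_filter.1 (Finset.mem_toList.1 hW)
    have h₂ := Finset.mem_filter.1 (Finset.mem_toList.1 hW')
    exact ⟨fun h => hne (h.antisymm (h₁.2 _ h₂.1 h)), fun h => hne ((h₂.2 _ h₁.1 h).antisymm h)⟩
  · simp only [Finset.mem_toList]
    rw [hu]
    refine subset_antisymm (Set.iUnion₂_subset fun W hW => ?_) (Set.iUnion₂_subset fun W hW => ?_)
    · obtain ⟨W', hW', hsub⟩ := hle W hW
      exact hsub.trans (Set.subset_biUnion_of_mem (u := fun W => W) hW')
    · exact Set.subset_biUnion_of_mem (u := fun W => W) (Finset.mem_filter.1 hW).1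

end Varieties

/-! ### Gradient spaces and Jacobian determinants -/

section Gradients

variable {n : ℕ}

/-- The gradient at `a`, as a linear map on polynomials. -/
noncomputable def grad (a : Fin n → ℝ) : MvPolynomial (Fin n) ℝ →ₗ[ℝ] Fin n → ℝ :=
  LinearMap.pi fun t => (aeval a).toLinearMap ∘ₗ (pderiv t).toLinearMap

theorem grad_apply (a : Fin n → ℝ) (f : MvPolynomial (Fin n) ℝ) (t : Fin n) :
    grad a f t = eval a (pderiv t f) :=
  rfl

theorem grad_mul (a : Fin n → ℝ) (f g : MvPolynomial (Fin n) ℝ) :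
    grad a (f * g) = eval a f • grad a g + eval a g • grad a f := by
  ext t
  simp [grad_apply]

/-- The space of gradients at `a` of the polynomials vanishing on `V`. -/
noncomputable def gradSpace (V : Set (Fin n → ℝ)) (a : Fin n → ℝ) : Submodule ℝ (Fin n → ℝ) :=
  ((idealOf V).restrictScalars ℝ).map (grad a)

theorem grad_mem_gradSpace {V : Set (Fin n → ℝ)} {f : MvPolynomial (Fin n) ℝ}
    (hf : f ∈ idealOf V) (a : Fin n → ℝ) : grad a f ∈ gradSpace V a :=
  ⟨f, hf, rfl⟩

/-- At a point of `V` the product rule loses the term in which the multiplier is differentiated, so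
gradients of generators already span. Hence the rank does not depend on the generators. -/
theorem rank_jacobian {V : Set (Fin n → ℝ)} {a : Fin n → ℝ} (ha : a ∈ V) {l : ℕ}
    {h : Fin l → MvPolynomial (Fin n) ℝ} (hh : Ideal.span (Set.range h) = idealOf V) :
    (jacobian h a).rank = Module.finrank ℝ (gradSpace V a) := by
  rw [Matrix.rank_eq_finrank_span_cols]
  have hcol : (jacobian h a).col = fun j => grad a (h j) := rfl
  suffices h : Submodule.span ℝ (Set.range fun j => grad a (h j)) = gradSpace V a by rw [hcol, h]
  refine le_antisymm (Submodule.span_le.2 ?_) ?_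
  · rintro _ ⟨j, rfl⟩
    exact grad_mem_gradSpace (hh ▸ Ideal.subset_span ⟨j, rfl⟩) a
  · rintro _ ⟨f, hf, rfl⟩
    change f ∈ idealOf V at hf
    rw [← hh] at hf
    induction hf using Submodule.span_induction with
    | mem x hx =>
      obtain ⟨j, rfl⟩ := hx
      exact Submodule.subset_span ⟨j, rfl⟩
    | zero => simp
    | add x y _ _ hx hy => rw [map_add]; exact add_mem hx hy
    | smul c x hx ih =>
      have h0 : eval a x = 0 := mem_idealOf.1 (hh ▸ hx) a ha
      rw [smul_eq_mul, grad_mul, h0, zero_smul, add_zero]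
      exact Submodule.smul_mem _ _ ih

/-- The square Jacobian matrix, with the gradients of `Φ` as columns. -/
noncomputable def jacMat (Φ : Fin n → MvPolynomial (Fin n) ℝ) :
    Matrix (Fin n) (Fin n) (MvPolynomial (Fin n) ℝ) :=
  Matrix.of fun t i => pderiv t (Φ i)

theorem eval_det_jacMat (Φ : Fin n → MvPolynomial (Fin n) ℝ) (a : Fin n → ℝ) :
    eval a (jacMat Φ).det = (Matrix.of fun t i => grad a (Φ i) t).det := by
  rw [RingHom.map_det]
  rfl

theorem linearIndependent_of_eval_det_ne_zero {Φ : Fin n → MvPolynomial (Fin n) ℝ}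
    {a : Fin n → ℝ} (h : eval a (jacMat Φ).det ≠ 0) :
    LinearIndependent ℝ fun i => grad a (Φ i) := by
  rw [eval_det_jacMat] at h
  exact Matrix.linearIndependent_cols_of_det_ne_zero h

/-- If the Jacobian determinant does not vanish at `a`, at most `finrank (gradSpace V a)` of its
columns are gradients of elements of `I(V)`. -/
theorem card_le_finrank_gradSpace {V : Set (Fin n → ℝ)} {a : Fin n → ℝ}
    {Φ : Fin n → MvPolynomial (Fin n) ℝ} (h : eval a (jacMat Φ).det ≠ 0) (s : Finset (Fin n))
    (hs : ∀ i ∈ s, Φ i ∈ idealOf V) : s.card ≤ Module.finrank ℝ (gradSpace V a) := by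
  have hi := (linearIndependent_of_eval_det_ne_zero h).comp ((↑) : s → Fin n)
    Subtype.val_injective
  have : LinearIndependent ℝ fun i : s =>
      (⟨_, grad_mem_gradSpace (hs i i.2) a⟩ : gradSpace V a) :=
    .of_comp (gradSpace V a).subtype hi
  simpa using this.fintype_card_le_finrank

theorem card_filter_le (d : ℕ) (hd : d ≤ n) :
    (Finset.univ.filter fun i : Fin n => d ≤ (i : ℕ)).card = n - d := by
  have h₁ := Finset.card_filter_add_card_filter_not (s := (Finset.univ : Finset (Fin n)))
    (fun i => (i : ℕ) < d)
  rw [Fin.card_filter_val_lt, Finset.card_univ, Fintype.card_fin, min_eq_right hd] at h₁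
  simp only [not_lt] at h₁
  omega

/-- Around a point `a` of `V` there are polynomial coordinates, centred at `a`, the last
`finrank (gradSpace V a)` of which vanish on `V`. -/
theorem exists_coordinates {V : Set (Fin n → ℝ)} {a : Fin n → ℝ} (ha : a ∈ V) {d : ℕ}
    (hd : n ≤ Module.finrank ℝ (gradSpace V a) + d) :
    ∃ Φ : Fin n → MvPolynomial (Fin n) ℝ, (∀ i, eval a (Φ i) = 0) ∧
      (∀ i : Fin n, d ≤ (i : ℕ) → Φ i ∈ idealOf V) ∧ eval a (jacMat Φ).det ≠ 0 := by
  obtain ⟨G', hG'⟩ := (gradSpace V a).exists_isCompl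
  have hsum := Submodule.finrank_add_eq_of_isCompl hG'
  rw [Module.finrank_fin_fun] at hsum
  -- The complement comes first and has at most `d` basis vectors, so every index from `d` on falls
  -- in `gradSpace V a`.
  let b := (((Module.finBasis ℝ G').prod (Module.finBasis ℝ (gradSpace V a))).map
    (Submodule.prodEquivOfIsCompl _ _ hG'.symm)).reindex
      (finSumFinEquiv.trans (finCongr ((add_comm _ _).trans hsum)))
  have hb (i : Fin n) (hi : d ≤ (i : ℕ)) : b i ∈ gradSpace V a := by
    obtain ⟨j, rfl⟩ := (finSumFinEquiv.trans (finCongr ((add_comm _ _).trans hsum))).surjective i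
    rcases j with j | j
    · simp at hi
      omega
    · simp [b]
  have hex (i : Fin n) : ∃ f : MvPolynomial (Fin n) ℝ, eval a f = 0 ∧
      (d ≤ (i : ℕ) → f ∈ idealOf V) ∧ grad a f = b i := by
    by_cases hi : d ≤ (i : ℕ)
    · obtain ⟨f, hf, hfb⟩ := hb i hi
      exact ⟨f, mem_idealOf.1 hf a ha, fun _ => hf, hfb⟩
    · refine ⟨∑ t, C (b i t) * (X t - C (a t)), by simp, fun h => absurd h hi, ?_⟩
      ext s
      simp [grad_apply, pderiv_X, Pi.single_apply, apply_ite]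
  choose Φ h₁ h₂ h₃ using hex
  refine ⟨Φ, h₁, h₂, ?_⟩
  rw [eval_det_jacMat]
  simp only [h₃]
  rw [← isUnit_iff_ne_zero, ← Matrix.isUnit_iff_isUnit_det,
    ← Matrix.linearIndependent_cols_iff_isUnit]
  exact b.linearIndependent

/-- If `I(V)` is prime and `k` polynomials are algebraically independent modulo `I(V)`, then
`k` is at most the codimension of the space of gradients at each point of `V`. -/
theorem finrank_gradSpace_add_le {V : Set (Fin n → ℝ)} [(idealOf V).IsPrime] {a : Fin n → ℝ}
    (ha : a ∈ V) {k : ℕ} (y : Fin k → MvPolynomial (Fin n) ℝ)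
    (hy : AlgebraicIndependent ℝ fun i => Ideal.Quotient.mk (idealOf V) (y i)) :
    Module.finrank ℝ (gradSpace V a) + k ≤ n := by
  have hr : Module.finrank ℝ (gradSpace V a) ≤ n := by
    simpa using (gradSpace V a).finrank_le
  set r := Module.finrank ℝ (gradSpace V a) with hrdef
  obtain ⟨Φ, -, hΦ, hdet⟩ := exists_coordinates ha (d := n - r) (by omega)
  let K := FractionRing (MvPolynomial (Fin n) ℝ ⧸ idealOf V)
  let q : MvPolynomial (Fin n) ℝ →+* K := (algebraMap _ K).comp (Ideal.Quotient.mk (idealOf V))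
  -- The determinant is nonzero at `a ∈ V`, so it is not in `I(V)` and survives in the function
  -- field.
  have hdetK : ((jacMat Φ).map q).det ≠ 0 := by
    rw [← RingHom.mapMatrix_apply, ← RingHom.map_det]
    intro h0
    refine hdet (mem_idealOf.1 ?_ a ha)
    rw [← Ideal.Quotient.eq_zero_iff_mem]
    exact IsFractionRing.injective (_ ⧸ idealOf V) K (h0.trans (map_zero _).symm)
  have hind := Matrix.linearIndependent_cols_of_det_ne_zero hdetK
  let e : Fin r → Fin n := fun j => ⟨n - r + j, by omega⟩
  have he : Function.Injective e := fun i j hij => by simpa [e, Fin.ext_iff] using hij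
  exact add_le_of_algebraicIndependent (idealOf V) K y hy (fun j => Φ (e j))
    (fun j => hΦ _ (by simp [e])) (hind.comp e he)

end Gradients

/-! ### Charts, differential equations and submanifold points -/

section Analysis

variable {n : ℕ}

theorem contDiff_eval (f : MvPolynomial (Fin n) ℝ) : ContDiff ℝ ∞ fun x => eval x f :=
  ((AnalyticOnNhd.eval_mvPolynomial f).contDiff).of_le le_top

theorem continuous_eval_point (f : MvPolynomial (Fin n) ℝ) : Continuous fun x => eval x f :=
  (contDiff_eval f).continuous

/-- The differential of a polynomial function. -/
noncomputable def diff (x : Fin n → ℝ) (f : MvPolynomial (Fin n) ℝ) : (Fin n → ℝ) →L[ℝ] ℝ :=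
  ∑ t, grad x f t • ContinuousLinearMap.proj t

theorem diff_apply (x : Fin n → ℝ) (f : MvPolynomial (Fin n) ℝ) (v : Fin n → ℝ) :
    diff x f v = grad x f ⬝ᵥ v := by
  simp [diff, dotProduct]

theorem hasFDerivAt_eval (f : MvPolynomial (Fin n) ℝ) (x : Fin n → ℝ) :
    HasFDerivAt (fun x => eval x f) (diff x f) x := by
  induction f using MvPolynomial.induction_on with
  | C a =>
    simp only [eval_C]
    refine (hasFDerivAt_const a x).congr_fderiv ?_
    ext v; simp [diff, grad_apply]
  | add f g hf hg =>
    simp only [map_add]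
    refine (hf.add hg).congr_fderiv ?_
    ext v; simp [diff_apply, add_dotProduct]
  | mul_X f s hf =>
    simp only [map_mul, eval_X]
    refine (hf.mul (hasFDerivAt_apply s x)).congr_fderiv ?_
    have hX : grad x (X s : MvPolynomial (Fin n) ℝ) = Pi.single s 1 := by
      ext t
      by_cases h : s = t
      · subst h; simp [grad_apply]
      · simp [grad_apply, pderiv_X_of_ne h, Ne.symm h]
    ext v
    simp [diff_apply, grad_mul, hX, add_dotProduct]

/-- The polynomial map with components `Φ`. -/
noncomputable def polyMap (Φ : Fin n → MvPolynomial (Fin n) ℝ) (x : Fin n → ℝ) : Fin n → ℝ :=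
  fun i => eval x (Φ i)

theorem contDiff_polyMap (Φ : Fin n → MvPolynomial (Fin n) ℝ) : ContDiff ℝ ∞ (polyMap Φ) :=
  contDiff_pi.2 fun i => contDiff_eval (Φ i)

theorem exists_equiv_hasFDerivAt_polyMap {Φ : Fin n → MvPolynomial (Fin n) ℝ} {x : Fin n → ℝ}
    (h : eval x (jacMat Φ).det ≠ 0) :
    ∃ e : (Fin n → ℝ) ≃L[ℝ] (Fin n → ℝ),
      HasFDerivAt (polyMap Φ) (e : (Fin n → ℝ) →L[ℝ] (Fin n → ℝ)) x := by
  let D : (Fin n → ℝ) →L[ℝ] (Fin n → ℝ) := ContinuousLinearMap.pi fun i => diff x (Φ i)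
  have hD : HasFDerivAt (polyMap Φ) D x := hasFDerivAt_pi.2 fun i => hasFDerivAt_eval (Φ i) x
  have hinj : Function.Injective (D : (Fin n → ℝ) →ₗ[ℝ] (Fin n → ℝ)) := by
    rw [injective_iff_map_eq_zero]
    intro v hv
    rw [eval_det_jacMat] at h
    refine Matrix.eq_zero_of_vecMul_eq_zero h ?_
    ext i
    have := congrFun hv i
    simpa [D, diff_apply, Matrix.vecMul, dotProduct_comm] using this
  refine ⟨(LinearEquiv.ofInjectiveEndo _ hinj).toContinuousLinearEquiv, ?_⟩
  convert hD using 1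
  ext v : 1
  rfl

/-- Polynomials with nonvanishing Jacobian determinant at a common zero define a chart there. -/
theorem exists_chart {Φ : Fin n → MvPolynomial (Fin n) ℝ} {a : Fin n → ℝ}
    (h0 : ∀ i, eval a (Φ i) = 0) (hdet : eval a (jacMat Φ).det ≠ 0) :
    ∃ (φ : OpenPartialHomeomorph (Fin n → ℝ) (Fin n → ℝ)) (ε : ℝ), 0 < ε ∧ a ∈ φ.source ∧
      (φ : (Fin n → ℝ) → Fin n → ℝ) = polyMap Φ ∧ φ.target = Metric.ball 0 ε ∧
      (∀ x ∈ φ.source, eval x (jacMat Φ).det ≠ 0) ∧ ContDiffOn ℝ ∞ φ.symm φ.target := by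
  obtain ⟨e, he⟩ := exists_equiv_hasFDerivAt_polyMap hdet
  have hc : ContDiffAt ℝ ∞ (polyMap Φ) a := (contDiff_polyMap Φ).contDiffAt
  let φ₀ := hc.toOpenPartialHomeomorph _ he (by simp)
  have hopen : IsOpen {x | eval x (jacMat Φ).det ≠ 0} :=
    isOpen_ne_fun (continuous_eval_point _) continuous_const
  let φ₁ := φ₀.restrOpen _ hopen
  have ha₁ : a ∈ φ₁.source := ⟨hc.mem_toOpenPartialHomeomorph_source he (by simp), hdet⟩
  have ha0 : φ₁ a = 0 := funext h0
  obtain ⟨ε, hε, hball⟩ := Metric.isOpen_iff.1 φ₁.open_target 0 (ha0 ▸ φ₁.map_source ha₁)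
  let φ := (φ₁.symm.restrOpen (Metric.ball 0 ε) Metric.isOpen_ball).symm
  have hsub {x} (hx : x ∈ φ.source) : x ∈ φ₁.source := hx.1
  -- A ball as target keeps the segment from `0` to any target point inside the chart.
  have htar : φ.target = Metric.ball 0 ε := Set.inter_eq_right.2 hball
  refine ⟨φ, ε, hε, ⟨ha₁, ?_⟩, rfl, htar, fun x hx => (hsub hx).2, fun y hy => ?_⟩
  · change φ₁ a ∈ Metric.ball 0 ε
    rw [ha0]
    exact Metric.mem_ball_self hε
  · obtain ⟨e', he'⟩ := exists_equiv_hasFDerivAt_polyMap (hsub (φ.map_target hy)).2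
    exact (φ.contDiffAt_symm hy he' (contDiff_polyMap Φ).contDiffAt).contDiffWithinAt

/-- A solution of a homogeneous linear system of differential equations with zero initial value
vanishes. -/
theorem eq_zero_of_linear_ode {l : ℕ} {F : ℝ → Fin l → ℝ} {A : ℝ → Fin l → Fin l → ℝ}
    (hA : ∀ j m, ContinuousOn (fun t => A t j m) (Set.Icc 0 1))
    (hF : ∀ t ∈ Set.Icc (0 : ℝ) 1, ∀ j, HasDerivAt (fun t => F t j) (∑ m, A t j m * F t m) t)
    (h0 : F 0 = 0) : F 1 = 0 := by
  have hF' : ∀ t ∈ Set.Icc (0 : ℝ) 1, HasDerivAt F (fun j => ∑ m, A t j m * F t m) t :=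
    fun t ht => hasDerivAt_pi.2 (hF t ht)
  have hcont : ContinuousOn (fun t => ∑ j, ∑ m, ‖A t j m‖) (Set.Icc 0 1) :=
    continuousOn_finsetSum _ fun j _ => continuousOn_finsetSum _ fun m _ => (hA j m).norm
  obtain ⟨K, hK⟩ := isCompact_Icc.exists_bound_of_continuousOn hcont
  refine eq_zero_of_abs_deriv_le_mul_abs_self_of_eq_zero_right (K := K) (a := 0) (b := 1)
    (fun t ht => (hF' t ht).continuousAt.continuousWithinAt)
    (fun t ht => (hF' t (Set.Ico_subset_Icc_self ht)).hasDerivWithinAt) h0 (fun t ht => ?_) 1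
    (by simp)
  have hKt := (Real.le_norm_self _).trans (hK t (Set.Ico_subset_Icc_self ht))
  have hK0 : 0 ≤ K := (by positivity : 0 ≤ ∑ j, ∑ m, ‖A t j m‖).trans hKt
  refine (pi_norm_le_iff_of_nonneg (by positivity)).2 fun j => ?_
  calc ‖∑ m, A t j m * F t m‖ ≤ ∑ m, ‖A t j m‖ * ‖F t‖ :=
        norm_sum_le_of_le _ fun m _ => by
          rw [norm_mul]
          gcongr
          exact norm_le_pi_norm _ m
    _ = (∑ m, ‖A t j m‖) * ‖F t‖ := by rw [Finset.sum_mul]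
    _ ≤ (∑ j, ∑ m, ‖A t j m‖) * ‖F t‖ := by
        refine mul_le_mul_of_nonneg_right ?_ (norm_nonneg _)
        exact Finset.single_le_sum (f := fun j => ∑ m, ‖A t j m‖) (fun _ _ => by positivity)
          (Finset.mem_univ j)
    _ ≤ K * ‖F t‖ := by gcongr

/-- Where the gradients of `I(V)` span a space of the largest dimension `n - d`, the variety is a
submanifold of dimension `d`. -/
theorem isSubmanifoldAt_of_finrank {V : Set (Fin n → ℝ)} (hV : IsVariety V) {a : Fin n → ℝ}
    (ha : a ∈ V) {d : ℕ} (hd : Module.finrank ℝ (gradSpace V a) + d = n)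
    (hmax : ∀ b ∈ V, Module.finrank ℝ (gradSpace V b) + d ≤ n) : IsSubmanifoldAt V d a := by
  obtain ⟨Φ, h0, hΦ, hdet⟩ := exists_coordinates ha hd.ge
  obtain ⟨φ, ε, hε, haφ, hφ, htar, hdetφ, hsymm⟩ := exists_chart h0 hdet
  have hφ' (x) : φ x = polyMap Φ x := congrFun hφ x
  refine ⟨by omega, ha, φ, haφ, hφ ▸ (contDiff_polyMap Φ).contDiffOn, hsymm, ?_⟩
  refine subset_antisymm ?_ fun y ⟨hy, hyd⟩ => ⟨φ.symm y, ⟨?_, φ.map_target hy⟩, φ.right_inv hy⟩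
  · rintro _ ⟨x, ⟨hxV, hx⟩, rfl⟩
    exact ⟨φ.map_source hx, fun i hi => by rw [hφ]; exact mem_idealOf.1 (hΦ i hi) x hxV⟩
  obtain ⟨l, h, hh⟩ := Submodule.fg_iff_exists_fin_generating_family.1
    (IsNoetherian.noetherian (idealOf V))
  have hmem (j : Fin l) : h j ∈ idealOf V := hh ▸ Submodule.subset_span ⟨j, rfl⟩
  -- Replacing a column of index below `d` by the gradient of `h j` gives `n - d + 1` columns from
  -- `I(V)`. By `hmax` these cannot be independent at a point of `V`.
  have hminor (j : Fin l) (i : Fin n) (hi : (i : ℕ) < d) :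
      (jacMat (Function.update Φ i (h j))).det ∈ idealOf V := by
    refine mem_idealOf.2 fun b hb => ?_
    by_contra hne
    have hcard := card_le_finrank_gradSpace (V := V) hne
      (insert i (Finset.univ.filter fun i : Fin n => d ≤ (i : ℕ))) fun i' hi' => by
        rcases eq_or_ne i' i with rfl | hii
        · simpa using hmem j
        · rw [Function.update_of_ne hii]
          exact hΦ i' (by simpa [hii] using hi')
    rw [Finset.card_insert_of_notMem (by simpa using hi), card_filter_le d (by omega)] at hcard
    have := hmax b hb
    omega
  have hc (j : Fin l) (i : Fin n) : ∃ c : Fin l → MvPolynomial (Fin n) ℝ, (i : ℕ) < d →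
      ∑ m, c m * h m = (jacMat (Function.update Φ i (h j))).det := by
    by_cases hi : (i : ℕ) < d
    · obtain ⟨c, hc⟩ := (Submodule.mem_span_range_iff_exists_fun _).1 (hh ▸ hminor j i hi)
      exact ⟨c, fun _ => hc⟩
    · exact ⟨0, fun h => absurd h hi⟩
  choose c hc using hc
  have hty (t : ℝ) (ht : t ∈ Set.Icc (0 : ℝ) 1) : t • y ∈ φ.target := by
    rw [htar, mem_ball_zero_iff] at hy ⊢
    rw [norm_smul, Real.norm_of_nonneg ht.1]
    exact (mul_le_of_le_one_left (norm_nonneg _) ht.2).trans_lt hy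
  -- This is the preimage of the segment from `0` to `y`, a path from `a` to the point that must be
  -- shown to lie in `V`.
  let γ : ℝ → Fin n → ℝ := fun t => φ.symm (t • y)
  let γ' : ℝ → Fin n → ℝ := fun t => fderiv ℝ φ.symm (t • y) y
  have hγ (t : ℝ) (ht : t ∈ Set.Icc (0 : ℝ) 1) : HasDerivAt γ (γ' t) t := by
    have h₁ : HasFDerivAt φ.symm (fderiv ℝ φ.symm (t • y)) (t • y) :=
      ((hsymm.contDiffAt (φ.open_target.mem_nhds (hty t ht))).differentiableAt
        (by simp)).hasFDerivAt
    have h₂ : HasDerivAt (fun t : ℝ => t • y) y t := by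
      simpa using (hasDerivAt_id t).smul_const y
    exact h₁.comp_hasDerivAt t h₂
  have hγd (f : MvPolynomial (Fin n) ℝ) (t : ℝ) (ht : t ∈ Set.Icc (0 : ℝ) 1) :
      HasDerivAt (fun t => eval (γ t) f) (grad (γ t) f ⬝ᵥ γ' t) t := by
    rw [← diff_apply]
    exact (hasFDerivAt_eval f (γ t)).comp_hasDerivAt t (hγ t ht)
  have hγΦ (i : Fin n) (t : ℝ) (ht : t ∈ Set.Icc (0 : ℝ) 1) :
      grad (γ t) (Φ i) ⬝ᵥ γ' t = y i := by
    refine (hγd (Φ i) t ht).unique ?_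
    have h₂ : HasDerivAt (fun t : ℝ => t * y i) (y i) t := by
      simpa using (hasDerivAt_id t).mul_const (y i)
    refine h₂.congr_of_eventuallyEq ?_
    have hev : ∀ᶠ s : ℝ in nhds t, s • y ∈ φ.target :=
      (continuous_id.smul continuous_const).continuousAt.eventually_mem
        (φ.open_target.mem_nhds (hty t ht))
    filter_upwards [hev] with s hs
    have := congrFun (φ.right_inv hs) i
    rwa [hφ'] at this
  let δ : ℝ → ℝ := fun t => eval (γ t) (jacMat Φ).det
  have hδ (t : ℝ) (ht : t ∈ Set.Icc (0 : ℝ) 1) : δ t ≠ 0 := hdetφ _ (φ.map_target (hty t ht))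
  have hγc : ContinuousOn γ (Set.Icc 0 1) := fun t ht => (hγ t ht).continuousAt.continuousWithinAt
  have hev (f : MvPolynomial (Fin n) ℝ) : ContinuousOn (fun t => eval (γ t) f) (Set.Icc 0 1) :=
    (continuous_eval_point f).comp_continuousOn hγc
  -- Cramer's rule expands the gradient of `h j` in the gradients of the `Φ i`, whose pairings with
  -- `γ' t` are the constants `y i`.
  have hcramer (j : Fin l) (t : ℝ) (ht : t ∈ Set.Icc (0 : ℝ) 1) :
      grad (γ t) (h j) ⬝ᵥ γ' t =
        (δ t)⁻¹ * ∑ i, y i * eval (γ t) (jacMat (Function.update Φ i (h j))).det := by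
    let M : Matrix (Fin n) (Fin n) ℝ := Matrix.of fun t' i => grad (γ t) (Φ i) t'
    have hM : M.det = δ t := (eval_det_jacMat Φ (γ t)).symm
    have hy' : Matrix.vecMul (γ' t) M = y := by
      ext i
      rw [← hγΦ i t ht, dotProduct_comm]
      rfl
    have hcr (i : Fin n) : M.cramer (grad (γ t) (h j)) i =
        eval (γ t) (jacMat (Function.update Φ i (h j))).det := by
      rw [Matrix.cramer_apply, eval_det_jacMat]
      congr 1
      ext t' i'
      rcases eq_or_ne i' i with rfl | hii
      · simp
      · simp [hii, M]
    rw [eq_inv_mul_iff_mul_eq₀ (hδ t ht), ← hM, dotProduct_comm, ← smul_eq_mul, ← dotProduct_smul,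
      ← Matrix.mulVec_cramer, Matrix.dotProduct_mulVec, hy', dotProduct]
    simp only [hcr]
  -- Terms with `i < d` are combinations of the `h m` by `hminor`; the others vanish since `y i =
  -- 0`. So the system is linear and homogeneous.
  have hfin := eq_zero_of_linear_ode (F := fun t j => eval (γ t) (h j))
    (A := fun t j m => (δ t)⁻¹ * ∑ i, y i * eval (γ t) (c j i m))
    (fun j m => ((hev _).inv₀ hδ).mul (continuousOn_finsetSum _ fun i _ =>
      continuousOn_const.mul (hev _)))
    (fun t ht j => by
      convert hγd (h j) t ht using 1
      rw [hcramer j t ht]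
      simp only [mul_assoc, ← Finset.mul_sum, Finset.sum_mul]
      rw [Finset.sum_comm]
      congr 1
      refine Finset.sum_congr rfl fun i _ => ?_
      rw [← Finset.mul_sum]
      by_cases hi : (i : ℕ) < d
      · rw [← hc j i hi]
        simp
      · simp [hyd i (not_lt.1 hi)])
    (funext fun j => by
      have : γ 0 = a := by
        have ha0 : φ a = 0 := by rw [hφ]; exact funext h0
        simp only [γ, zero_smul]
        rw [← ha0, φ.left_inv haφ]
      simpa [this] using mem_idealOf.1 (hmem j) a ha)
  have hspan : idealOf V ≤ RingHom.ker (eval (γ 1)) := by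
    rw [← hh, Submodule.span_le]
    rintro _ ⟨j, rfl⟩
    exact congrFun hfin j
  refine hV.mem_of_forall fun f hf => ?_
  simpa [γ] using hspan hf

/-- A variety that is somewhere a submanifold of dimension `k` has `k` polynomial functions that
are algebraically independent. -/
theorem IsSubmanifoldAt.exists_algebraicIndependent {V : Set (Fin n → ℝ)} {k : ℕ} {b : Fin n → ℝ}
    (h : IsSubmanifoldAt V k b) :
    ∃ y : Fin k → MvPolynomial (Fin n) ℝ,
      AlgebraicIndependent ℝ fun i => Ideal.Quotient.mk (idealOf V) (y i) := by
  obtain ⟨hk, hb, φ, hbφ, hφ, hsymm, himg⟩ := h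
  let π : (Fin n → ℝ) →L[ℝ] (Fin k → ℝ) :=
    ContinuousLinearMap.pi fun i => ContinuousLinearMap.proj (Fin.castLE hk i)
  let ι : (Fin k → ℝ) →L[ℝ] (Fin n → ℝ) :=
    ContinuousLinearMap.pi fun i => if hi : (i : ℕ) < k then ContinuousLinearMap.proj ⟨i, hi⟩ else 0
  have hι (u : Fin k → ℝ) (i : Fin n) : ι u i = if hi : (i : ℕ) < k then u ⟨i, hi⟩ else 0 := by
    by_cases hi : (i : ℕ) < k <;> simp [ι, hi]
  have hmem : φ b ∈ {y ∈ φ.target | ∀ i : Fin n, k ≤ (i : ℕ) → y i = 0} :=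
    himg ▸ ⟨b, ⟨hb, hbφ⟩, rfl⟩
  have hu₀ : ι (π (φ b)) = φ b := by
    ext i
    rw [hι]
    split_ifs with hi
    · rfl
    · exact (hmem.2 i (not_lt.1 hi)).symm
  have hπι : π.comp ι = ContinuousLinearMap.id ℝ _ := by
    ext u i
    simp [π, hι]
  -- Linearizing the first `k` chart coordinates at `b` keeps the functions polynomial, while `g`,
  -- their expression in the chart, has identity derivative and is locally onto.
  let L : (Fin n → ℝ) →L[ℝ] (Fin k → ℝ) := π.comp (fderiv ℝ φ b)
  let g : (Fin k → ℝ) → (Fin k → ℝ) := fun u => L (φ.symm (ι u))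
  have hdφ : HasFDerivAt φ (fderiv ℝ φ b) (φ.symm (φ b)) := by
    rw [φ.left_inv hbφ]
    exact ((hφ.contDiffAt (φ.open_source.mem_nhds hbφ)).differentiableAt (by simp)).hasFDerivAt
  have hsd : HasStrictFDerivAt φ.symm (fderiv ℝ φ.symm (φ b)) (φ b) :=
    (hsymm.contDiffAt (φ.open_target.mem_nhds hmem.1)).hasStrictFDerivAt (by simp)
  have hcomp : (fderiv ℝ φ b).comp (fderiv ℝ φ.symm (φ b)) = ContinuousLinearMap.id ℝ _ := by
    refine (hdφ.comp (φ b) (hsd.hasFDerivAt)).unique ?_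
    refine (hasFDerivAt_id (φ b)).congr_of_eventuallyEq ?_
    filter_upwards [φ.open_target.mem_nhds hmem.1] with z hz
    exact φ.right_inv hz
  have hg : HasStrictFDerivAt g
      ((ContinuousLinearEquiv.refl ℝ (Fin k → ℝ)) : (Fin k → ℝ) →L[ℝ] (Fin k → ℝ)) (π (φ b)) := by
    rw [← hu₀] at hsd
    refine (L.hasStrictFDerivAt.comp (π (φ b))
      (hsd.comp (π (φ b)) ι.hasStrictFDerivAt)).congr_fderiv ?_
    rw [hu₀, ← ContinuousLinearMap.comp_assoc, ContinuousLinearMap.comp_assoc π, hcomp,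
      ContinuousLinearMap.comp_id, hπι]
    rfl
  have hT : {u | ι u ∈ φ.target} ∈ nhds (π (φ b)) :=
    ι.continuous.continuousAt.eventually_mem (φ.open_target.mem_nhds (hu₀.symm ▸ hmem.1))
  have hgT : g '' {u | ι u ∈ φ.target} ∈ nhds (g (π (φ b))) := by
    rw [← hg.map_nhds_eq_of_equiv]
    exact Filter.image_mem_map hT
  obtain ⟨ε, hε, hball⟩ := Metric.mem_nhds_iff.1 hgT
  let y : Fin k → MvPolynomial (Fin n) ℝ := fun i => ∑ t, C (L (Pi.single t 1) i) * X t
  have hy (x : Fin n → ℝ) : (fun i => eval x (y i)) = L x := by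
    ext i
    conv_rhs => rw [← Finset.univ_sum_single x]
    simp only [y, map_sum, Finset.sum_apply, map_mul, eval_C, eval_X]
    refine Finset.sum_congr rfl fun t _ => ?_
    have : (Pi.single t (x t) : Fin n → ℝ) = x t • Pi.single t 1 := by
      rw [← Pi.single_smul, smul_eq_mul, mul_one]
    rw [this, map_smul, Pi.smul_apply, smul_eq_mul, mul_comm]
  refine ⟨y, algebraicIndependent_iff.2 fun P hP => ?_⟩
  have hPmem : aeval y P ∈ idealOf V := by
    rw [← Ideal.Quotient.eq_zero_iff_mem, ← hP]
    exact (congrArg (fun F : MvPolynomial (Fin k) ℝ →ₐ[ℝ] _ => F P)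
      (comp_aeval y (Ideal.Quotient.mkₐ ℝ (idealOf V))))
  -- In the sup norm a ball is a product of intervals, and a polynomial vanishing on a product of
  -- infinite sets is zero.
  refine funext_set (fun i => Metric.ball (g (π (φ b)) i) ε) (fun i => ?_) fun z hz => ?_
  · rw [Real.ball_eq_Ioo]
    exact Set.Ioo_infinite (by linarith)
  · rw [← ball_pi _ hε] at hz
    obtain ⟨u, hu, rfl⟩ := hball hz
    have huV : φ.symm (ι u) ∈ V := by
      have : ι u ∈ φ '' (V ∩ φ.source) :=
        himg ▸ ⟨hu, fun i hi => by rw [hι, dif_neg (not_lt.2 hi)]⟩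
      obtain ⟨x, ⟨hxV, hx⟩, hxu⟩ := this
      rwa [← hxu, φ.left_inv hx]
    have h0 := mem_idealOf.1 hPmem _ huV
    rw [← aeval_eq_eval, ← AlgHom.comp_apply, comp_aeval] at h0
    rw [map_zero]
    simp only [g, ← hy]
    exact h0

end Analysis

/-! ### The singular locus is a proper subvariety -/

section SingularLocus

variable {n : ℕ}

theorem bddAbove_dim (V : Set (Fin n → ℝ)) : BddAbove {k | ∃ a, IsSubmanifoldAt V k a} :=
  ⟨n, fun _ ⟨_, h⟩ => h.1⟩

theorem IsSubmanifoldAt.le_dim {V : Set (Fin n → ℝ)} {k : ℕ} {a : Fin n → ℝ}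
    (h : IsSubmanifoldAt V k a) : k ≤ dim V :=
  le_csSup (bddAbove_dim V) ⟨a, h⟩

theorem exists_isSubmanifoldAt_dim {V : Set (Fin n → ℝ)} (h : dim V ≠ 0) :
    ∃ a, IsSubmanifoldAt V (dim V) a := by
  refine Nat.sSup_mem (Set.nonempty_iff_ne_empty.2 fun he => h ?_) (bddAbove_dim V)
  rw [dim, he, csSup_empty, bot_eq_zero]

variable {V : Set (Fin n → ℝ)}

theorem IsIrredVariety.finrank_gradSpace_add_dim_le (hV : IsIrredVariety V) (h : dim V ≠ 0)
    {a : Fin n → ℝ} (ha : a ∈ V) : Module.finrank ℝ (gradSpace V a) + dim V ≤ n := by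
  have := hV.isPrime ⟨a, ha⟩
  obtain ⟨b, hb⟩ := exists_isSubmanifoldAt_dim h
  obtain ⟨y, hy⟩ := hb.exists_algebraicIndependent
  exact finrank_gradSpace_add_le ha y hy

/-- An irreducible variety of positive dimension has a regular point. -/
theorem IsIrredVariety.exists_finrank_gradSpace_add_dim_eq (hV : IsIrredVariety V)
    (h : dim V ≠ 0) : ∃ a ∈ V, Module.finrank ℝ (gradSpace V a) + dim V = n := by
  obtain ⟨b, hb⟩ := exists_isSubmanifoldAt_dim h
  let R : Set ℕ := {r | ∃ a ∈ V, Module.finrank ℝ (gradSpace V a) = r}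
  have hR : BddAbove R := ⟨n, by
    rintro _ ⟨a, ha, rfl⟩
    have := hV.finrank_gradSpace_add_dim_le h ha
    omega⟩
  obtain ⟨a, ha, har⟩ := Nat.sSup_mem (s := R) ⟨_, b, hb.2.1, rfl⟩ hR
  have hle := hV.finrank_gradSpace_add_dim_le h ha
  -- At a point of maximal rank this forces `n - sSup R ≤ dim V`, the reverse of `hle`.
  have hsub : IsSubmanifoldAt V (n - sSup R) a := by
    refine isSubmanifoldAt_of_finrank hV.1 ha (by omega) fun c hc => ?_
    have : Module.finrank ℝ (gradSpace V c) ≤ sSup R := le_csSup hR ⟨c, hc, rfl⟩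
    omega
  have := hsub.le_dim
  exact ⟨a, ha, by omega⟩

theorem mem_regLocus_iff {a : Fin n → ℝ} :
    a ∈ regLocus V ↔ a ∈ V ∧ Module.finrank ℝ (gradSpace V a) + dim V = n := by
  refine and_congr_right fun ha => ⟨?_, fun h => ?_⟩
  · rintro ⟨l, h, hh, hr⟩
    rwa [rank_jacobian ha hh] at hr
  · obtain ⟨l, g, hg⟩ := Submodule.fg_iff_exists_fin_generating_family.1
      (IsNoetherian.noetherian (idealOf V))
    exact ⟨l, g, hg, by rwa [rank_jacobian ha hg]⟩

theorem IsIrredVariety.isVariety_singLocus (hV : IsIrredVariety V) (h : dim V ≠ 0) :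
    IsVariety (singLocus V) := by
  -- Some such determinant is nonzero at `a` exactly when the gradient space has dimension at least
  -- `n - dim V`, which by `hle` means exactly that.
  convert hV.1.inter_zeros {f | ∃ Φ : Fin n → MvPolynomial (Fin n) ℝ,
    (∀ i : Fin n, dim V ≤ (i : ℕ) → Φ i ∈ idealOf V) ∧ f = (jacMat Φ).det} using 1
  ext a
  rw [singLocus, Set.mem_sdiff, mem_regLocus_iff]
  refine and_congr_right fun ha => ?_
  have hle := hV.finrank_gradSpace_add_dim_le h ha
  constructor
  · rintro hne _ ⟨Φ, hΦ, rfl⟩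
    by_contra hdet
    have := card_le_finrank_gradSpace (V := V) hdet
      (Finset.univ.filter fun i : Fin n => dim V ≤ (i : ℕ)) fun i hi => hΦ i (Finset.mem_filter.1 hi).2
    rw [card_filter_le _ (by omega)] at this
    exact hne ⟨ha, by omega⟩
  · rintro hz ⟨-, heq⟩
    obtain ⟨Φ, -, hΦ, hdet⟩ := exists_coordinates ha heq.ge
    exact hdet (hz _ ⟨Φ, hΦ, rfl⟩)

theorem IsIrredVariety.singLocus_ssubset (hV : IsIrredVariety V) (h : dim V ≠ 0) :
    singLocus V ⊂ V := by
  obtain ⟨a, ha, heq⟩ := hV.exists_finrank_gradSpace_add_dim_eq h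
  exact ⟨Set.sdiff_subset, fun hle => (hle ha).2 (mem_regLocus_iff.2 ⟨ha, heq⟩)⟩

end SingularLocus

/-! ### Termination and the invariant -/

section Algorithm

variable {n : ℕ}

/-- Every run from the state `s` is finite. -/
abbrev Halts (s : State n) : Prop := Acc (flip Step) s

theorem halts_examine {W : Set (Fin n → ℝ)} {rest : List (Task n)}
    (hrest : ∀ A B, Halts ⟨rest, A, B⟩)
    (ih : dim W ≠ 0 → ∀ A B, Halts ⟨Task.decompose (singLocus W) :: rest, A, B⟩)
    (A B : Set (Set (Fin n → ℝ))) : Halts ⟨Task.examine W :: rest, A, B⟩ := by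
  refine ⟨_, fun s hs => ?_⟩
  cases hs with
  | zeroDim _ _ _ _ h => exact hrest _ _
  | posDim _ _ _ _ h => exact ih h _ _

/-- Quantifying over every halting remainder of the stack makes the recursive call compose with the
rest of the loop: Noetherian induction handles the recursion and list induction the loop. `A` and
`B` stay arbitrary because no step is conditioned on them. -/
theorem halts_decompose {U : Set (Fin n → ℝ)} (hU : IsVariety U) :
    ∀ (rest : List (Task n)), (∀ A B, Halts ⟨rest, A, B⟩) →
      ∀ A B, Halts ⟨Task.decompose U :: rest, A, B⟩ := by
  refine hU.induction (P := fun U => ∀ (rest : List (Task n)), (∀ A B, Halts ⟨rest, A, B⟩) →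
      ∀ A B, Halts ⟨Task.decompose U :: rest, A, B⟩) fun U hU ih rest hrest A B => ?_
  refine ⟨_, fun s hs => ?_⟩
  cases hs with
  | decompose _ L _ _ _ hL =>
    have key (L' : List (Set (Fin n → ℝ))) (hL' : ∀ W ∈ L', W ∈ L) :
        ∀ A B, Halts ⟨L'.map Task.examine ++ rest, A, B⟩ := by
      induction L' with
      | nil => exact hrest
      | cons W L' ihL =>
        have hWL := hL' W (by simp)
        have hW := hL.2.1 W hWL
        have hWU : W ⊆ U := by
          rw [hL.2.2.2]
          exact Set.subset_biUnion_of_mem (u := fun W => W) hWL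
        have hr := ihL fun T hT => hL' T (by simp [hT])
        exact halts_examine hr fun h => ih _ (hW.isVariety_singLocus h)
          ((hW.singLocus_ssubset h).trans_subset hWU) _ hr
    exact key L (fun _ h => h) _ _

theorem halts_start {V : Set (Fin n → ℝ)} (hV : IsVariety V) : Halts (start V) :=
  halts_decompose hV [] (fun _ _ => ⟨_, fun _ hs => nomatch hs⟩) _ _

/-- The invariant of the algorithm with input `V`. -/
structure Inv (V : Set (Fin n → ℝ)) (s : State n) : Prop where
  decompose : ∀ U, Task.decompose U ∈ s.todo → IsVariety U ∧ U ⊆ V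
  examine : ∀ W, Task.examine W ∈ s.todo → IsIrredVariety W ∧ W ⊆ V
  finite_A : s.A.Finite
  finite_B : s.B.Finite
  -- A zero-dimensional member of `A` must still await examination, so none is left once the stack
  -- is empty.
  mem_A : ∀ W ∈ s.A, IsIrredVariety W ∧ W ⊆ V ∧ (dim W = 0 → Task.examine W ∈ s.todo)
  mem_B : ∀ W ∈ s.B, IsIrredVariety W ∧ W ⊆ V ∧ dim W = 0
  cover : ∀ x ∈ V, (∃ W ∈ s.A ∪ s.B, x ∈ W) ∨ ∃ U, Task.decompose U ∈ s.todo ∧ x ∈ U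

theorem inv_start {V : Set (Fin n → ℝ)} (hV : IsVariety V) : Inv V (start V) where
  decompose U hU := by
    obtain rfl : U = V := by simpa [start] using hU
    exact ⟨hV, subset_rfl⟩
  examine W hW := by simp [start] at hW
  finite_A := Set.finite_empty
  finite_B := Set.finite_empty
  mem_A W hW := hW.elim
  mem_B W hW := hW.elim
  cover x hx := Or.inr ⟨V, by simp [start], hx⟩

theorem Inv.step {V : Set (Fin n → ℝ)} {s s' : State n} (hs : Inv V s) (h : Step s s') :
    Inv V s' := by
  cases h with
  | decompose U L rest A B hL =>
    obtain ⟨hd, he, hA, hB, hmA, hmB, hcov⟩ := hs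
    have hLU (W) (hW : W ∈ L) : W ⊆ V := by
      refine subset_trans ?_ (hd U (by simp)).2
      rw [hL.2.2.2]
      exact Set.subset_biUnion_of_mem (u := fun W => W) hW
    refine ⟨fun T hT => hd T ?_, fun W hW => ?_, hA.union (List.finite_toSet L), hB, ?_, hmB, ?_⟩
    · simpa using Or.inr hT
    · simp only [List.mem_append, List.mem_map, Task.examine.injEq, exists_eq_right] at hW
      rcases hW with hW | hW
      · exact ⟨hL.2.1 W hW, hLU W hW⟩
      · exact he W (List.mem_cons_of_mem _ hW)
    · rintro W (hW | hW)
      · obtain ⟨h₁, h₂, h₃⟩ := hmA W hW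
        refine ⟨h₁, h₂, fun h0 => ?_⟩
        have := h₃ h0
        simp only [List.mem_cons, reduceCtorEq, false_or] at this
        simp [this]
      · exact ⟨hL.2.1 W hW, hLU W hW, fun _ => List.mem_append_left _ (List.mem_map_of_mem hW)⟩
    · intro x hx
      rcases hcov x hx with ⟨W, hW, hxW⟩ | ⟨T, hT, hxT⟩
      · exact Or.inl ⟨W, hW.imp_left Or.inl, hxW⟩
      · rcases List.mem_cons.1 hT with hTU | hT
        · obtain rfl : T = U := by simpa using hTU
          rw [hL.2.2.2] at hxT
          obtain ⟨W, hW, hxW⟩ := Set.mem_iUnion₂.1 hxT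
          exact Or.inl ⟨W, Or.inl (Or.inr hW), hxW⟩
        · exact Or.inr ⟨T, List.mem_append_right _ hT, hxT⟩
  | zeroDim W rest A B h0 =>
    obtain ⟨hd, he, hA, hB, hmA, hmB, hcov⟩ := hs
    refine ⟨fun T hT => hd T (List.mem_cons_of_mem _ hT), fun T hT => he T
      (List.mem_cons_of_mem _ hT), hA.sdiff, hB.union (Set.finite_singleton W), ?_, ?_, ?_⟩
    · rintro T ⟨hT, hne⟩
      obtain ⟨h₁, h₂, h₃⟩ := hmA T hT
      refine ⟨h₁, h₂, fun hT0 => (List.mem_cons.1 (h₃ hT0)).resolve_left fun heq => hne ?_⟩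
      simpa using heq
    · rintro T (hT | rfl)
      · exact hmB T hT
      · obtain ⟨h₁, h₂⟩ := he T (by simp)
        exact ⟨h₁, h₂, h0⟩
    · intro x hx
      rcases hcov x hx with ⟨T, hT, hxT⟩ | ⟨T, hT, hxT⟩
      · refine Or.inl ⟨T, ?_, hxT⟩
        rcases eq_or_ne T W with rfl | hne
        · exact Or.inr (Or.inr rfl)
        · exact hT.imp (fun h => ⟨h, hne⟩) Or.inl
      · exact Or.inr ⟨T, by simpa using hT, hxT⟩
  | posDim W rest A B h0 =>
    obtain ⟨hd, he, hA, hB, hmA, hmB, hcov⟩ := hs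
    refine ⟨fun T hT => ?_, fun T hT => he T ?_, hA, hB, fun T hT => ?_, hmB, fun x hx => ?_⟩
    · rcases List.mem_cons.1 hT with hTW | hT
      · obtain rfl : T = singLocus W := by simpa using hTW
        obtain ⟨h₁, h₂⟩ := he W (by simp)
        exact ⟨h₁.isVariety_singLocus h0, Set.sdiff_subset.trans h₂⟩
      · exact hd T (List.mem_cons_of_mem _ hT)
    · simpa using Or.inr hT
    · obtain ⟨h₁, h₂, h₃⟩ := hmA T hT
      refine ⟨h₁, h₂, fun hT0 => ?_⟩
      refine List.mem_cons_of_mem _ ((List.mem_cons.1 (h₃ hT0)).resolve_left fun heq => h0 ?_)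
      obtain rfl : T = W := by simpa using heq
      exact hT0
    · refine (hcov x hx).imp_right fun ⟨T, hT, hxT⟩ => ⟨T, ?_, hxT⟩
      exact List.mem_cons_of_mem _ (by simpa using hT)

theorem Reaches.inv {V : Set (Fin n → ℝ)} (hV : IsVariety V) {s : State n} (h : Reaches V s) :
    Inv V s := by
  induction h with
  | refl => exact inv_start hV
  | tail _ hstep ih => exact ih.step hstep

/-- The algorithm does not get stuck. -/
theorem Inv.exists_step {V : Set (Fin n → ℝ)} {s : State n} (hs : Inv V s) (h : s.todo ≠ []) :
    ∃ s', Step s s' := by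
  obtain ⟨_ | ⟨_ | W, rest⟩, A, B⟩ := s
  · exact absurd rfl h
  · obtain ⟨L, hL⟩ := (hs.decompose _ (List.mem_cons_self ..)).1.exists_isIrredDecomp
    exact ⟨_, .decompose _ L _ _ _ hL⟩
  · by_cases h0 : dim W = 0
    · exact ⟨_, .zeroDim _ _ _ _ h0⟩
    · exact ⟨_, .posDim _ _ _ _ h0⟩

theorem terminates {V : Set (Fin n → ℝ)} (hV : IsVariety V) : Terminates V := by
  refine ⟨?_, fun s hs => (hs.inv hV).exists_step⟩
  rintro ⟨s, h0, hstep⟩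
  have key (x : State n) (hx : Halts x) : ∀ t, s t ≠ x := by
    induction hx with
    | intro x _ ih =>
      rintro t rfl
      exact ih _ (hstep t) (t + 1) rfl
  exact key _ (halts_start hV) 0 h0

theorem exists_outputs {V : Set (Fin n → ℝ)} (hV : IsVariety V) : ∃ A B, Outputs V A B := by
  have key (x : State n) (hx : Halts x) : Reaches V x → ∃ A B, Outputs V A B := by
    induction hx with
    | intro x _ ih =>
      intro hr
      by_cases hnil : x.todo = []
      · obtain ⟨todo, A, B⟩ := x
        subst hnil
        exact ⟨A, B, hr⟩
      · obtain ⟨x', hx'⟩ := (hr.inv hV).exists_step hnil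
        exact ih x' hx' (hr.tail hx')
  exact key _ (halts_start hV) .refl

end Algorithm

end SingDecomp

theorem mainTheorem10 (n : ℕ) (V : Set (Fin n → ℝ)) (hV : SingDecomp.IsVariety V) :
    SingDecomp.Terminates V ∧
    (∃ A B, SingDecomp.Outputs V A B) ∧
    ∀ A B, SingDecomp.Outputs V A B →
      (A.Finite ∧ B.Finite ∧ ∀ W ∈ A ∪ B, SingDecomp.IsVariety W) ∧
      (∀ W ∈ A, SingDecomp.IsIrredVariety W ∧ 0 < SingDecomp.dim W) ∧
      (∀ W ∈ B, SingDecomp.IsIrredVariety W ∧ SingDecomp.dim W = 0) ∧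
      V = ⋃ W ∈ A ∪ B, W := by
  refine ⟨SingDecomp.terminates hV, SingDecomp.exists_outputs hV, fun A B h => ?_⟩
  obtain ⟨-, -, hA, hB, hmA, hmB, hcov⟩ := SingDecomp.Reaches.inv hV h
  refine ⟨⟨hA, hB, ?_⟩, fun W hW => ⟨(hmA W hW).1, ?_⟩,
    fun W hW => ⟨(hmB W hW).1, (hmB W hW).2.2⟩, subset_antisymm (fun x hx => ?_) ?_⟩
  · rintro W (hW | hW)
    · exact (hmA W hW).1.1
    · exact (hmB W hW).1.1
  · exact Nat.pos_of_ne_zero fun h0 => List.not_mem_nil ((hmA W hW).2.2 h0)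
  · rcases hcov x hx with ⟨W, hW, hxW⟩ | ⟨U, hU, -⟩
    · exact Set.mem_biUnion hW hxW
    · exact absurd hU List.not_mem_nil
  · refine Set.iUnion₂_subset fun W hW => ?_
    rcases hW with hW | hW
    · exact (hmA W hW).2.1
    · exact (hmB W hW).2.1
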